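/- A hierarchical domain of height $h$ over $[n]$ is a rooted tree of prefixes whose leaves are the $n$ elements of $[n]$; leaves have level $0$, the root has level $h$, and levels increase towards the root. For a set $T$ of prefixes let $\mathrm{elements}(T)\subseteq[n]$ be the set of leaves below (or equal to) a member of $T$. For a stream $u_1,\dots,u_t\in[n]$ let $f_e^*=|\{s\le t: u_s=e\}|$ and, for a prefix $p$, $f_p^*=\sum_{e\in\mathrm{elements}(\{p\})}f_e^*$. A set $P$ of identified prefixes with estimates $(f_p)_{p\in P}$ solves the hierarchical heavy hitters (HHH) problem with threshold $\gamma$ and error $\varepsilon$ on this stream if (accuracy) $f_p^*-\varepsilon t\le f_p\le f_p^*$ for every $p\in P$, and (coverage) for every prefix $q\notin P$, $\sum f_e^*\le\gamma t$, where the sum is over all $e\in\mathrm{elements}(\{q\})\setminus\mathrm{elements}(\{p\in P: p\text{ is a descendant of }q\})$. A streaming algorithm using $s$ bits of space has a memory state in $\{0,1\}^s$, initially a fixed state; in each round it receives an update in $[n]$ and a fresh batch of finitely many uniform random bits, and its new memory state is a function of the old one, the update and the fresh bits. Its response is a function of its memory state. In the white-box adversarial game with $m$ rounds, each update is chosen (possibly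 at random) by a computationally unbounded adversary depending on all previous updates, all previous memory states and all previous random bits of the algorithm. **Theorem.** There is an absolute constant $C>0$ such that for all $n$, all $h\ge 1$, every hierarchical domain of height $h$ over $[n]$, every $\varepsilon\in(0,1)$ and every $m\ge 16$ there is a streaming algorithm using at most $$C\left(\frac h\varepsilon\Bigl(\log n+\log\frac1\varepsilon+\log\log\log m\Bigr)+\log\log m\right)$$ bits of space such that, against every white-box adversary in the game with $m$ rounds, with probability at least $3/4$ the following holds: at every time $t\in\{1,\dots,m\}$ and for every threshold $\gamma\in[\varepsilon,1)$ supplied with the query, the response solves the HHH problem with threshold $\gamma$ and error $\varepsilon$ on the stream $u_1,\dots,u_t$. -/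

import Mathlib

open scoped Classical in
/-- Total number of occurrences in `stream` of the elements of `S`. -/
noncomputable def freqOn {n : ℕ} (stream : List (Fin n)) (S : Set (Fin n)) : ℝ :=
  ∑ x : Fin n, if x ∈ S then (stream.count x : ℝ) else 0

/-- A hierarchical domain of height `h` over the universe `[n]`: a rooted tree of prefixes, where
`p ≤ q` means that `p` is a descendant of `q` (or equal to it) and `⊤` is the root.  The leaves are
the `n` elements of the universe; they have level `0`, the root has level `h`, and levels increase
from descendants to ancestors. -/
structure HierarchicalDomain (Prefix : Type*) [PartialOrder Prefix] [OrderTop Prefix]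
    (n h : ℕ) where
  leaf : Fin n → Prefix
  level : Prefix → ℕ
  leaf_injective : Function.Injective leaf
  isMin_iff_leaf : ∀ p : Prefix, IsMin p ↔ p ∈ Set.range leaf
  ancestors_chain : ∀ p q r : Prefix, p ≤ q → p ≤ r → q ≤ r ∨ r ≤ q
  level_lt : ∀ p q : Prefix, p < q → level p < level q
  level_leaf : ∀ x, level (leaf x) = 0
  level_root : level ⊤ = h

namespace HierarchicalDomain

variable {Prefix : Type*} [PartialOrder Prefix] [OrderTop Prefix] {n h : ℕ}

/-- The union of the sets of elements that are descendants of a prefix in `T`. -/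
def elements (D : HierarchicalDomain Prefix n h) (T : Set Prefix) : Set (Fin n) :=
  {x | ∃ p ∈ T, D.leaf x ≤ p}

end HierarchicalDomain

/-- A reported answer: the set of identified prefixes, with a frequency estimate for each of them
(the values of `estimate` outside `identified` are ignored). -/
structure HHHReport (Prefix : Type*) where
  identified : Set Prefix
  estimate : Prefix → ℝ

/-- `out` solves the hierarchical heavy hitters problem with threshold `γ` and error `ε` on
`stream`: every identified prefix `p` has an accurate estimate, and for every prefix `q` that is not
identified, the elements below `q` that are not below an identified descendant of `q` have total
frequency at most `γ` times the stream length. -/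
def SolvesHHH {Prefix : Type*} [PartialOrder Prefix] [OrderTop Prefix] {n h : ℕ}
    (D : HierarchicalDomain Prefix n h) (γ ε : ℝ) (stream : List (Fin n))
    (out : HHHReport Prefix) : Prop :=
  (∀ p ∈ out.identified,
    freqOn stream (D.elements {p}) - ε * stream.length ≤ out.estimate p ∧
      out.estimate p ≤ freqOn stream (D.elements {p})) ∧
  (∀ q, q ∉ out.identified →
    freqOn stream (D.elements {q} \ D.elements {p | p ∈ out.identified ∧ p ≤ q})
      ≤ γ * stream.length)

/-- A one-pass randomized streaming algorithm with updates in `U` and answers in `A`.  Its memory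
consists of `space` bits; in every round it acquires a fresh batch of `coins` random bits.  The new
memory depends only on the old memory, the update and the fresh batch (in particular, neither a
clock nor old random bits are available unless stored in the memory). -/
structure StreamAlg (U A : Type*) where
  space : ℕ
  coins : ℕ
  init : Fin space → Bool
  update : (Fin space → Bool) → U → (Fin coins → Bool) → (Fin space → Bool)
  response : (Fin space → Bool) → A

namespace StreamAlg

variable {U A : Type*}

/-- What is visible after one round: the update, the random bits and the new memory state
(and hence also the answer, which is a function of the memory state). -/
structure Round (alg : StreamAlg U A) where
  update : U
  bits : Fin alg.coins → Bool
  state : Fin alg.space → Bool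

/-- The memory state after the rounds in a history, which lists the most recent round first. -/
def memory (alg : StreamAlg U A) : List alg.Round → (Fin alg.space → Bool)
  | [] => alg.init
  | r :: _ => r.state

/-- A white-box adversary chooses the next update, possibly at random, on the basis of the full
history: all previous updates, random bits and memory states. -/
abbrev Adversary (alg : StreamAlg U A) := List alg.Round → PMF U

/-- The distribution of the history (most recent round first) after the given number of rounds of
the game between the algorithm and a white-box adversary. -/
noncomputable def game (alg : StreamAlg U A) (adv : alg.Adversary) : ℕ → PMF (List alg.Round)
  | 0 => PMF.pure []
  | t + 1 => (game alg adv t).bind fun H =>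
      (adv H).bind fun u =>
        (PMF.uniformOfFintype (Fin alg.coins → Bool)).map fun R =>
          (⟨u, R, alg.update (alg.memory H) u R⟩ : alg.Round) :: H

/-- The updates of a history (in reverse order of arrival). -/
def stream (alg : StreamAlg U A) (H : List alg.Round) : List U :=
  H.map Round.update

end StreamAlg

/-! Each update is sampled with probability `2 ^ (-k)` and then counts for `2 ^ k` updates; whenever
the number of samples reaches `2 * half`, all counters are halved and `k` increases. One Misra-Gries
table per level summarizes the samples. With `half` of order `ε⁻² (log n + log log m)`, a counter
and its key take `O(log n + log (1/ε) + log log log m)` bits, and only the exponent `k` costs `log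
log m`. No clock is stored: the total sampled weight estimates the time `t`.

The coins are fresh, so whatever the adversary has seen, the error of the sampled weight of a fixed
set changes by a centred increment. Exponential potentials of this error are supermartingales as
long as `2 ^ k` is of order at most `t / half`. This proviso follows from accuracy on the whole
universe so far, so the process is stopped at the first deviation (`game_le_of_potential`,
`sum_totalPotential_cons_le`). A union bound over `log m` dyadic time scales, rather than `m` times,
and over at most `n * (n + 1)` sets (`card_family_le`) explains the size of `half`.

Without deviations, the errors from sampling, Misra-Gries decrements and rounding add up to less
than `ε * t` (`lowerEstimate_spec`). Reporting all prefixes with positive lower estimate suffices: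
an unreported one has frequency at most `ε * t`, even before descendants are discounted. -/

open scoped ENNReal

/-! ### Expectations and a maximal inequality for the white-box game. -/

/-- The expectation of a nonnegative function under a discrete distribution. -/
noncomputable def PMF.expect {α : Type*} (p : PMF α) (g : α → ℝ≥0∞) : ℝ≥0∞ :=
  ∑' a, p a * g a

namespace PMF

variable {α β : Type*}

theorem expect_pure (a : α) (g : α → ℝ≥0∞) : (PMF.pure a).expect g = g a := by
  unfold expect
  rw [tsum_eq_single a]
  · simp
  · intro b hb
    simp [hb]

theorem expect_bind (p : PMF α) (f : α → PMF β) (g : β → ℝ≥0∞) :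
    (p.bind f).expect g = p.expect fun a => (f a).expect g := by
  unfold expect
  simp only [PMF.bind_apply, ← ENNReal.tsum_mul_right, ← ENNReal.tsum_mul_left]
  rw [ENNReal.tsum_comm]
  simp only [mul_assoc]

theorem expect_map (p : PMF α) (f : α → β) (g : β → ℝ≥0∞) :
    (p.map f).expect g = p.expect fun a => g (f a) := by
  simp [PMF.map, expect_bind, expect_pure]

theorem expect_mono_support (p : PMF α) {g g' : α → ℝ≥0∞} (hg : ∀ a ∈ p.support, g a ≤ g' a) :
    p.expect g ≤ p.expect g' := by
  refine ENNReal.tsum_le_tsum fun a => ?_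
  by_cases ha : a ∈ p.support
  · exact mul_le_mul_right (hg a ha) _
  · rw [PMF.mem_support_iff, not_not] at ha
    simp [ha]

theorem expect_const (p : PMF α) (c : ℝ≥0∞) : p.expect (fun _ => c) = c := by
  simp [expect, ENNReal.tsum_mul_right]

theorem expect_uniformOfFintype [Fintype α] [Nonempty α] (g : α → ℝ≥0∞) :
    (PMF.uniformOfFintype α).expect g = (Fintype.card α : ℝ≥0∞)⁻¹ * ∑ a, g a := by
  simp [expect, tsum_fintype, Finset.mul_sum]

theorem toOuterMeasure_eq_expect (p : PMF α) (s : Set α) :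
    p.toOuterMeasure s = p.expect (s.indicator 1) := by
  rw [PMF.toOuterMeasure_apply]
  refine tsum_congr fun a => ?_
  by_cases ha : a ∈ s <;> simp [ha]

theorem one_le_toOuterMeasure_add_compl (p : PMF α) (s : Set α) :
    1 ≤ p.toOuterMeasure s + p.toOuterMeasure sᶜ := by
  calc (1 : ℝ≥0∞) = p.toOuterMeasure Set.univ :=
        ((PMF.toOuterMeasure_apply_eq_one_iff p _).2 (Set.subset_univ _)).symm
    _ = p.toOuterMeasure (s ∪ sᶜ) := by rw [Set.union_compl_self]
    _ ≤ _ := MeasureTheory.measure_union_le _ _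

end PMF

namespace StreamAlg

variable {U A : Type*}

/-- The histories in which every memory state is the one that the algorithm computes. -/
def IsPlay (alg : StreamAlg U A) : List alg.Round → Prop
  | [] => True
  | r :: H => r.state = alg.update (alg.memory H) r.update r.bits ∧ IsPlay alg H

theorem isPlay_of_mem_support (alg : StreamAlg U A) (adv : alg.Adversary) (t : ℕ) :
    ∀ H ∈ (alg.game adv t).support, alg.IsPlay H ∧ H.length = t := by
  induction t with
  | zero =>
    intro H hH
    have : H = [] := by simpa [game] using hH
    subst this
    simp [IsPlay]
  | succ t ih =>
    intro H hH
    simp only [game, PMF.mem_support_bind_iff, PMF.mem_support_map_iff] at hH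
    obtain ⟨H', hH', u, -, R, -, rfl⟩ := hH
    obtain ⟨h1, h2⟩ := ih H' hH'
    exact ⟨⟨rfl, h1⟩, by simp [h2]⟩

/-- A maximal inequality for the white-box game: if a potential is nonnegative, does not increase in
expectation as long as nothing bad has happened, and is at least `1` at every bad history, then the
probability that something bad ever happens is at most the initial potential. -/
theorem game_le_of_potential (alg : StreamAlg U A) (adv : alg.Adversary) (m : ℕ)
    (Bad : List alg.Round → Prop) (φ : List alg.Round → ℝ) (δ : ℝ) (h_nonneg : ∀ H, 0 ≤ φ H)
    (h_step : ∀ H : List alg.Round, H.length < m → (∀ past, past <:+ H → ¬ Bad past) →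
      ∀ (u : U) (x : (Fin alg.coins → Bool) → (Fin alg.space → Bool)),
        ∑ R, φ (⟨u, R, x R⟩ :: H) ≤ 2 ^ alg.coins * φ H)
    (h_bad : ∀ H, Bad H → 1 ≤ φ H) (h_init : φ [] ≤ δ) :
    1 - ENNReal.ofReal δ ≤ (alg.game adv m).toOuterMeasure
      {H | (alg.IsPlay H ∧ H.length = m) ∧ ∀ past, past <:+ H → ¬ Bad past} := by
  classical
  -- The stopped potential: frozen at `1` from the first bad history on, so the supermartingale step
  -- is needed only before it.
  set Ψ : List alg.Round → ℝ≥0∞ := fun H =>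
    if ∃ past, past <:+ H ∧ Bad past then 1 else ENNReal.ofReal (φ H) with hΨ
  have hle : ∀ H, (∀ past, past <:+ H.tail → ¬ Bad past) → Ψ H ≤ ENNReal.ofReal (φ H) := by
    intro H hH
    simp only [hΨ]
    split_ifs with hex
    · obtain ⟨past, hp, hb⟩ := hex
      have : past = H := by
        cases H with
        | nil => simpa using hp
        | cons r H =>
          rcases List.suffix_cons_iff.1 hp with h | h
          · exact h
          · exact absurd hb (hH past h)
      subst this
      exact ENNReal.one_le_ofReal.2 (h_bad _ hb)
    · exact le_rfl
  have hexp : ∀ t ≤ m, (alg.game adv t).expect Ψ ≤ ENNReal.ofReal δ := by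
    intro t
    induction t with
    | zero =>
      intro _
      rw [game, PMF.expect_pure]
      by_cases hb : Bad []
      · refine le_trans ?_ (ENNReal.ofReal_le_ofReal h_init)
        refine le_trans ?_ (ENNReal.one_le_ofReal.2 (h_bad _ hb))
        simp only [hΨ]
        split_ifs with hex
        · exact le_rfl
        · exact absurd ⟨[], List.suffix_rfl, hb⟩ hex
      · refine (hle [] ?_).trans (ENNReal.ofReal_le_ofReal h_init)
        intro past hp
        have : past = [] := by simpa using hp
        rwa [this]
    | succ t ih =>
      intro ht
      refine le_trans ?_ (ih (by omega))
      rw [game, PMF.expect_bind]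
      refine PMF.expect_mono_support _ fun H hH => ?_
      obtain ⟨-, hlen⟩ := isPlay_of_mem_support alg adv t H hH
      rw [PMF.expect_bind]
      refine (PMF.expect_mono_support (adv H) (g' := fun _ => Ψ H) fun u _ => ?_).trans
        (PMF.expect_const _ _).le
      rw [PMF.expect_map]
      by_cases hex : ∃ past, past <:+ H ∧ Bad past
      · have h1 : Ψ H = 1 := by simp only [hΨ, if_pos hex]
        rw [h1]
        refine (PMF.expect_mono_support _ (g' := fun _ => 1) fun R _ => ?_).trans
          (PMF.expect_const _ _).le
        obtain ⟨past, hp, hb⟩ := hex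
        simp only [hΨ]
        rw [if_pos ⟨past, hp.trans (List.suffix_cons _ _), hb⟩]
      · have h1 : Ψ H = ENNReal.ofReal (φ H) := by simp only [hΨ, if_neg hex]
        have hno : ∀ past, past <:+ H → ¬ Bad past := fun past hp hb => hex ⟨past, hp, hb⟩
        rw [h1]
        refine (PMF.expect_mono_support _ (g' := fun R => ENNReal.ofReal
          (φ (⟨u, R, alg.update (alg.memory H) u R⟩ :: H))) fun R _ => hle _ hno).trans ?_
        rw [PMF.expect_uniformOfFintype, ← ENNReal.ofReal_sum_of_nonneg fun R _ => h_nonneg _]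
        have hcard : (Fintype.card (Fin alg.coins → Bool) : ℝ≥0∞)
            = ENNReal.ofReal (2 ^ alg.coins) := by
          rw [ENNReal.ofReal_pow (by norm_num)]
          simp
        have hpos : (0 : ℝ) < 2 ^ alg.coins := by positivity
        rw [hcard, ← ENNReal.ofReal_inv_of_pos hpos,
          ← ENNReal.ofReal_mul (inv_nonneg.2 hpos.le)]
        refine ENNReal.ofReal_le_ofReal ?_
        rw [inv_mul_le_iff₀ hpos]
        exact h_step H (by omega) hno u _
  set good : Set (List alg.Round) := {H | ∀ past, past <:+ H → ¬ Bad past} with hgood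
  have hcompl : (alg.game adv m).toOuterMeasure goodᶜ ≤ ENNReal.ofReal δ := by
    refine le_trans ?_ (hexp m le_rfl)
    rw [PMF.toOuterMeasure_eq_expect]
    refine PMF.expect_mono_support _ fun H _ => ?_
    refine Set.indicator_le (fun H hH => ?_) H
    have hex : ∃ past, past <:+ H ∧ Bad past := by
      simpa [hgood] using hH
    simp only [hΨ, if_pos hex, Pi.one_apply, le_refl]
  have hsub : (alg.game adv m).toOuterMeasure good ≤ (alg.game adv m).toOuterMeasure
      {H | (alg.IsPlay H ∧ H.length = m) ∧ ∀ past, past <:+ H → ¬ Bad past} := by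
    refine PMF.toOuterMeasure_mono _ ?_
    rintro H ⟨h1, h2⟩
    exact ⟨isPlay_of_mem_support alg adv m H h2, h1⟩
  refine le_trans ?_ hsub
  rw [tsub_le_iff_right]
  exact ((alg.game adv m).one_le_toOuterMeasure_add_compl good).trans (by gcongr)

end StreamAlg

/-! ### The Misra-Gries summary. -/

/-- One step of the Misra-Gries summary with `K` counters: the counter of the arriving key is
increased, and all counters are decreased if more than `K` of them are in use then. -/
def misraGries {n : ℕ} (K : ℕ) (c : Fin n → ℕ) : Option (Fin n) → Fin n → ℕ
  | none => c
  | some x =>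
    if K < (Finset.univ.filter fun y => (c + Pi.single x 1 : Fin n → ℕ) y ≠ 0).card then
      fun y => (c + Pi.single x 1 : Fin n → ℕ) y - 1
    else c + Pi.single x 1

/-- A decrement returns the arriving key to its old counter and revives no other key. -/
theorem misraGries_card_support {n K : ℕ} {c : Fin n → ℕ} (o : Option (Fin n))
    (hc : (Finset.univ.filter fun y => c y ≠ 0).card ≤ K) :
    (Finset.univ.filter fun y => misraGries K c o y ≠ 0).card ≤ K := by
  cases o with
  | none => exact hc
  | some x =>
    simp only [misraGries]
    split_ifs with h
    · refine le_trans (Finset.card_le_card fun y => ?_) hc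
      simp only [Finset.mem_filter, Finset.mem_univ, true_and, Pi.add_apply]
      rcases eq_or_ne y x with rfl | hyx
      · simp
      · simp only [Pi.single_eq_of_ne hyx]
        omega
    · exact not_lt.1 h

/-- Here `d` is `1` if the counters are decreased and `0` otherwise. A decrease hits at least `K +
1` positive counters, so each unit of loss is charged to that much removed mass. -/
theorem misraGries_spec {n : ℕ} (K : ℕ) (c : Fin n → ℕ) (o : Option (Fin n)) :
    (∀ y, misraGries K c o y ≤ c y + if o = some y then 1 else 0) ∧
    ∃ d : ℕ, (∀ y, (c y + if o = some y then 1 else 0) ≤ misraGries K c o y + d) ∧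
      ∑ y, misraGries K c o y + d * (K + 1) ≤ ∑ y, c y + 1 := by
  cases o with
  | none => exact ⟨fun y => by simp [misraGries], 0, fun y => by simp [misraGries],
      by simp [misraGries]⟩
  | some x =>
    have hval : ∀ y, (c + Pi.single x 1 : Fin n → ℕ) y = c y + if some x = some y then 1 else 0 := by
      intro y
      by_cases h : x = y
      · subst h; simp
      · simp [h, Ne.symm h]
    have hsum : ∑ y, (c + Pi.single x 1 : Fin n → ℕ) y = ∑ y, c y + 1 := by
      simp [Finset.sum_add_distrib]
    simp only [misraGries]
    split_ifs with h
    · refine ⟨fun y => by rw [← hval]; exact Nat.sub_le _ _, 1,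
        fun y => by rw [← hval]; simp only; omega, ?_⟩
      rw [← hsum]
      have hsplit : ∑ y, ((c + Pi.single x 1 : Fin n → ℕ) y - 1)
          + (Finset.univ.filter fun y => (c + Pi.single x 1 : Fin n → ℕ) y ≠ 0).card
          = ∑ y, (c + Pi.single x 1 : Fin n → ℕ) y := by
        rw [Finset.card_filter, ← Finset.sum_add_distrib]
        refine Finset.sum_congr rfl fun y _ => ?_
        split_ifs <;> omega
      simp only
      omega
    · exact ⟨fun y => (hval y).le, 0, fun y => by rw [← hval]; omega, by rw [hsum]; omega⟩

/-! ### The sampling sketch and its deterministic invariants. -/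

/-- The state of the sampling sketch: updates are sampled with probability `2 ^ (-exponent)`, every
sampled update counts for `2 ^ exponent` updates, `total` counts the samples, and there is one table
of counters for every index in `ι`. -/
@[ext]
structure Sketch (n : ℕ) (ι : Type*) where
  exponent : ℕ
  total : ℕ
  table : ι → Fin n → ℕ

/-- The parameters of the sampling sketch: the number of counters in a table, half of the bound on
the counters, the number of random bits per round, and the key of an update in a table. -/
structure SketchParams (n : ℕ) (ι : Type*) where
  capacity : ℕ
  half : ℕ
  coins : ℕ
  key : ι → Fin n → Option (Fin n)

/-- The batches of random bits for which an update is sampled with probability `2 ^ (-k)`. -/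
def Sampled {L : ℕ} (k : ℕ) (R : Fin L → Bool) : Prop :=
  ∀ i : Fin L, (i : ℕ) < k → R i = true

instance {L : ℕ} (k : ℕ) (R : Fin L → Bool) : Decidable (Sampled k R) :=
  inferInstanceAs (Decidable (∀ i : Fin L, (i : ℕ) < k → R i = true))

theorem card_sampled {L k : ℕ} (hk : k ≤ L) :
    (Finset.univ.filter fun R : Fin L → Bool => Sampled k R).card * 2 ^ k = 2 ^ L := by
  have h1 : (Finset.univ.filter fun R : Fin L → Bool => Sampled k R)
      = Fintype.piFinset fun i : Fin L => if (i : ℕ) < k then {true} else Finset.univ := by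
    ext R
    rw [Finset.mem_filter, Fintype.mem_piFinset]
    simp only [Finset.mem_univ, true_and, Sampled]
    refine forall_congr' fun i => ?_
    split_ifs with h <;> simp [h]
  have h2 : ∀ i : Fin L, (if (i : ℕ) < k then ({true} : Finset Bool) else Finset.univ).card
      = if (i : ℕ) < k then 1 else 2 := by
    intro i
    split_ifs <;> simp
  rw [h1, Fintype.card_piFinset, Finset.prod_congr rfl fun i _ => h2 i,
    Fin.prod_univ_eq_prod_range (fun i => if i < k then 1 else 2) L, Finset.prod_ite,
    Finset.prod_const_one, one_mul, Finset.prod_const, ← pow_add]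
  congr 1
  have h3 : (Finset.range L).filter (fun i => ¬ i < k) = Finset.Ico k L := by
    ext i
    simp only [Finset.mem_filter, Finset.mem_range, Finset.mem_Ico]
    omega
  rw [h3, Nat.card_Ico]
  omega

namespace SketchParams

variable {n : ℕ} {ι : Type*} (P : SketchParams n ι)

/-- The sketch after a sampled update. -/
def insert (s : Sketch n ι) (u : Fin n) : Sketch n ι :=
  if s.total + 1 = 2 * P.half then
    ⟨s.exponent + 1, P.half, fun j x => misraGries P.capacity (s.table j) (P.key j u) x / 2⟩
  else ⟨s.exponent, s.total + 1, fun j => misraGries P.capacity (s.table j) (P.key j u)⟩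

/-- The sketch after an update with the given random bits. -/
def step (s : Sketch n ι) (u : Fin n) (R : Fin P.coins → Bool) : Sketch n ι :=
  if Sampled s.exponent R then P.insert s u else s

/-- The sketch after a history of updates and random bits, the most recent round first. -/
def run : List (Fin n × (Fin P.coins → Bool)) → Sketch n ι
  | [] => ⟨0, 0, fun _ _ => 0⟩
  | r :: H => P.step (run H) r.1 r.2

open scoped Classical in
/-- The total weight of the sampled updates in `S`. -/
noncomputable def weight (S : Set (Fin n)) : List (Fin n × (Fin P.coins → Bool)) → ℕ
  | [] => 0
  | r :: H => weight S H +
      if Sampled (P.run H).exponent r.2 ∧ r.1 ∈ S then 2 ^ (P.run H).exponent else 0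

/-- Exact, because halving takes place when the count is the even number `2 * half`. -/
theorem weight_univ (H : List (Fin n × (Fin P.coins → Bool))) :
    P.weight Set.univ H = (P.run H).total * 2 ^ (P.run H).exponent := by
  induction H with
  | nil => simp [weight, run]
  | cons r H ih =>
    simp only [weight, run, step, Set.mem_univ, and_true, ih]
    split_ifs with h
    · unfold insert
      split_ifs with h2
      · have : ((P.run H).total + 1) * 2 ^ (P.run H).exponent
            = 2 * P.half * 2 ^ (P.run H).exponent := by rw [h2]
        simp only [pow_succ]
        linarith
      · simp only
        ring
    · rfl

/-- The invariants that keep the sketch small. -/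
structure Bounded (s : Sketch n ι) : Prop where
  total_lt : s.total < 2 * P.half
  half_le : s.exponent = 0 ∨ P.half ≤ s.total
  table_le : ∀ j x, s.table j x ≤ s.total
  card_le : ∀ j, (Finset.univ.filter fun x => s.table j x ≠ 0).card ≤ P.capacity

theorem bounded_run (hb : 1 ≤ P.half) (H : List (Fin n × (Fin P.coins → Bool))) :
    P.Bounded (P.run H) := by
  induction H with
  | nil => exact ⟨by simp [run]; omega, Or.inl rfl, by simp [run], by simp [run]⟩
  | cons r H ih =>
    obtain ⟨h1, h2, h3, h4⟩ := ih
    have hc := fun j => misraGries_card_support (P.key j r.1) (h4 j)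
    have hle : ∀ j x, misraGries P.capacity ((P.run H).table j) (P.key j r.1) x
        ≤ (P.run H).total + 1 := by
      intro j x
      refine ((misraGries_spec _ _ _).1 x).trans ?_
      have := h3 j x
      split_ifs <;> omega
    simp only [run, step]
    split_ifs with h
    · unfold insert
      split_ifs with h5
      · refine ⟨by simp only; omega, Or.inr le_rfl, fun j x => ?_, fun j => ?_⟩
        · have := hle j x
          simp only
          omega
        · refine (Finset.card_le_card fun x => ?_).trans (hc j)
          simp only [Finset.mem_filter, Finset.mem_univ, true_and]
          intro hx hx'
          simp [hx'] at hx
      · refine ⟨by simp only; omega, ?_, hle, hc⟩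
        simp only
        omega
    · exact ⟨h1, h2, h3, h4⟩

/-- `D` collects the decrements, each with the sample weight of its time; the remaining loss, at
most `2 ^ exponent - 1`, is rounding in the halvings. -/
theorem table_spec (j : ι) (H : List (Fin n × (Fin P.coins → Bool))) :
    (∀ x, 2 ^ (P.run H).exponent * (P.run H).table j x ≤ P.weight {u | P.key j u = some x} H) ∧
    ∃ D : ℕ, (∀ x, P.weight {u | P.key j u = some x} H + 1
        ≤ 2 ^ (P.run H).exponent * (P.run H).table j x + D + 2 ^ (P.run H).exponent) ∧
      D * (P.capacity + 1) + 2 ^ (P.run H).exponent * ∑ x, (P.run H).table j x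
        ≤ P.weight Set.univ H := by
  induction H with
  | nil => exact ⟨by simp [run], 0, by simp [run, weight], by simp [run]⟩
  | cons r H ih =>
    obtain ⟨h1, D, h2, h3⟩ := ih
    simp only [run, step, weight, Set.mem_univ, and_true, Set.mem_ofPred_eq]
    by_cases hs : Sampled (P.run H).exponent r.2
    swap
    · simp only [hs, false_and, if_false, add_zero]
      exact ⟨h1, D, h2, h3⟩
    simp only [hs, true_and, if_true]
    obtain ⟨g1, d, g2, g3⟩ :=
      misraGries_spec P.capacity ((P.run H).table j) (P.key j r.1)
    set a := 2 ^ (P.run H).exponent with ha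
    set c := (P.run H).table j with hc
    set c' := misraGries P.capacity c (P.key j r.1) with hc'
    have hY : ∀ x, (if P.key j r.1 = some x then a else 0)
        = a * if P.key j r.1 = some x then 1 else 0 := by
      intro x
      split_ifs <;> simp
    have e1 : ∀ x, a * c' x ≤
        P.weight {u | P.key j u = some x} H + if P.key j r.1 = some x then a else 0 := by
      intro x
      have := Nat.mul_le_mul_left a (g1 x)
      rw [hY]
      rw [mul_add] at this
      exact this.trans (Nat.add_le_add_right (h1 x) _)
    have e2 : ∀ x, P.weight {u | P.key j u = some x} H
        + (if P.key j r.1 = some x then a else 0) + 1 ≤ a * c' x + (D + a * d) + a := by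
      intro x
      have := Nat.mul_le_mul_left a (g2 x)
      rw [hY]
      rw [mul_add, mul_add] at this
      have := h2 x
      omega
    have e3 : (D + a * d) * (P.capacity + 1) + a * ∑ x, c' x ≤ P.weight Set.univ H + a := by
      have := Nat.mul_le_mul_left a g3
      nlinarith
    unfold insert
    split_ifs with h5
    · refine ⟨fun x => ?_, D + a * d, fun x => ?_, ?_⟩
      · refine le_trans ?_ (e1 x)
        rw [pow_succ, ← ha, mul_assoc]
        exact Nat.mul_le_mul_left _ (Nat.mul_div_le _ _)
      · refine (e2 x).trans ?_
        simp only [pow_succ, ← ha]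
        -- Halving loses at most one unit of weight `a`, which turns the rounding error `a - 1` into
        -- `2 * a - 1`.
        have : c' x ≤ 2 * (c' x / 2) + 1 := by omega
        have := Nat.mul_le_mul_left a this
        simp only [← hc', ← hc]
        linarith
      · refine le_trans ?_ e3
        simp only [pow_succ, ← ha, mul_assoc, Finset.mul_sum]
        gcongr with x
        exact Nat.mul_div_le _ _
    · exact ⟨e1, D + a * d, e2, e3⟩

end SketchParams

/-! ### Frequencies and the exponential moment of one sampling step. -/

open scoped Classical in
theorem freqOn_cons {n : ℕ} (u : Fin n) (l : List (Fin n)) (S : Set (Fin n)) :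
    freqOn (u :: l) S = freqOn l S + if u ∈ S then 1 else 0 := by
  unfold freqOn
  have h : ∀ x : Fin n, (if x ∈ S then ((u :: l).count x : ℝ) else 0)
      = (if x ∈ S then (l.count x : ℝ) else 0)
        + if u = x then (if u ∈ S then 1 else 0) else 0 := by
    intro x
    by_cases hu : u = x
    · subst hu
      by_cases hS : u ∈ S <;> simp [hS]
    · rw [List.count_cons_of_ne hu]
      simp [hu]
  rw [Finset.sum_congr rfl fun x _ => h x, Finset.sum_add_distrib, Finset.sum_ite_eq]
  simp

theorem freqOn_nil {n : ℕ} (S : Set (Fin n)) : freqOn [] S = 0 := by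
  simp [freqOn]

theorem freqOn_univ {n : ℕ} (l : List (Fin n)) : freqOn l Set.univ = l.length := by
  induction l with
  | nil => simp [freqOn_nil]
  | cons u l ih => simp [freqOn_cons, ih]

/-- A bound for the moment generating function of the sampling error in one round. -/
theorem sum_exp_sampled_le {L k : ℕ} (hk : k ≤ L) (μ r : ℝ) (hr : 0 ≤ r) (hμ : |μ| * r ≤ 1)
    (h : k = 0 ∨ 2 ^ k ≤ r) :
    ∑ R : Fin L → Bool, Real.exp (μ * ((if Sampled k R then 2 ^ k else 0) - 1))
      ≤ 2 ^ L * Real.exp (μ ^ 2 * r) := by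
  -- For `k = 0` the increment vanishes; this case is separate since `r` may be smaller than `1`.
  rcases h with rfl | h
  · have h0 : ∀ R : Fin L → Bool, Sampled 0 R := fun R i hi => absurd hi (Nat.not_lt_zero _)
    simp only [h0, if_true, pow_zero, sub_self, mul_zero, Real.exp_zero, Finset.sum_const,
      nsmul_eq_mul, mul_one]
    have : (1 : ℝ) ≤ Real.exp (μ ^ 2 * r) := Real.one_le_exp (by positivity)
    simpa using this
  set a : ℝ := 2 ^ k with ha
  have hapos : 0 < a := by positivity
  set N : ℝ := ((Finset.univ.filter fun R : Fin L → Bool => Sampled k R).card : ℝ) with hN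
  have hcard : N * a = 2 ^ L := by
    rw [hN, ha]
    exact_mod_cast card_sampled hk
  have hNnn : 0 ≤ N := Nat.cast_nonneg _
  have hsum : ∑ R : Fin L → Bool, Real.exp (μ * ((if Sampled k R then a else 0) - 1))
      = Real.exp (-μ) * (N * Real.exp (μ * a) + (N * a - N)) := by
    have hterm : ∀ R : Fin L → Bool, Real.exp (μ * ((if Sampled k R then a else 0) - 1))
        = Real.exp (-μ) * (1 + if Sampled k R then Real.exp (μ * a) - 1 else 0) := by
      intro R
      split_ifs
      · rw [add_sub_cancel, ← Real.exp_add]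
        ring_nf
      · simp
    rw [Finset.sum_congr rfl fun R _ => hterm R, ← Finset.mul_sum, Finset.sum_add_distrib,
      ← Finset.sum_filter, Finset.sum_const, Finset.sum_const, nsmul_eq_mul, nsmul_eq_mul, hcard]
    simp only [Finset.card_univ, Fintype.card_pi, Fintype.card_bool, Finset.prod_const,
      Fintype.card_fin, ← hN]
    push_cast
    ring
  rw [hsum, ← hcard]
  have hsmall : |μ * a| ≤ 1 := by
    rw [abs_mul, abs_of_pos hapos]
    exact (mul_le_mul_of_nonneg_left h (abs_nonneg _)).trans hμ
  have hexp : Real.exp (μ * a) ≤ 1 + μ * a + (μ * a) ^ 2 := by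
    have := (abs_le.1 (Real.abs_exp_sub_one_sub_id_le hsmall)).2
    linarith
  have h1 : N * Real.exp (μ * a) + (N * a - N) ≤ N * a * (1 + (μ + μ ^ 2 * a)) := by
    have := mul_le_mul_of_nonneg_left hexp hNnn
    nlinarith
  have h2 : 1 + (μ + μ ^ 2 * a) ≤ Real.exp (μ + μ ^ 2 * r) := by
    have h3 := Real.add_one_le_exp (μ + μ ^ 2 * r)
    have h4 := mul_le_mul_of_nonneg_left h (sq_nonneg μ)
    linarith
  calc Real.exp (-μ) * (N * Real.exp (μ * a) + (N * a - N))
      ≤ Real.exp (-μ) * (N * a * Real.exp (μ + μ ^ 2 * r)) := by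
        gcongr
        exact h1.trans (mul_le_mul_of_nonneg_left h2 (by positivity))
    _ = N * a * (Real.exp (-μ) * Real.exp (μ + μ ^ 2 * r)) := by ring
    _ = N * a * Real.exp (μ ^ 2 * r) := by
        rw [← Real.exp_add]
        ring_nf

/-! ### Exponential potentials for the sampling error. -/

namespace SketchParams

variable {n : ℕ} {ι : Type*} (P : SketchParams n ι)

/-- The error of the sampled weight of `S` as an estimate of its frequency. -/
noncomputable def dev (S : Set (Fin n)) (H : List (Fin n × (Fin P.coins → Bool))) : ℝ :=
  P.weight S H - freqOn (H.map Prod.fst) S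

open scoped Classical in
theorem dev_cons (S : Set (Fin n)) (u : Fin n) (R : Fin P.coins → Bool)
    (H : List (Fin n × (Fin P.coins → Bool))) :
    P.dev S ((u, R) :: H) = P.dev S H + if u ∈ S then
      (if Sampled (P.run H).exponent R then 2 ^ (P.run H).exponent else 0) - 1 else 0 := by
  simp only [dev, weight, List.map_cons, freqOn_cons]
  by_cases hS : u ∈ S <;> by_cases hR : Sampled (P.run H).exponent R <;> simp [hS, hR]
  · ring
  · ring

/-- An exponential potential for the error on `S`, up to time `2 * T`. -/
noncomputable def potential (S : Set (Fin n)) (μ δ r T : ℝ)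
    (H : List (Fin n × (Fin P.coins → Bool))) : ℝ :=
  if (H.length : ℝ) ≤ 2 * T then
    Real.exp (μ * P.dev S H - |μ| * δ * T + μ ^ 2 * r * (2 * T - H.length))
  else 0

theorem potential_nonneg (S : Set (Fin n)) (μ δ r T : ℝ)
    (H : List (Fin n × (Fin P.coins → Bool))) : 0 ≤ P.potential S μ δ r T H := by
  unfold potential
  split_ifs <;> positivity

/-- The reserve `μ ^ 2 * r * (2 * T - H.length)` shrinks by `μ ^ 2 * r` per round, which pays for
the exponential moment of the increment. Past time `2 * T` the potential is zero, so the exponent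
must be controlled only up to then. -/
theorem sum_potential_cons_le (S : Set (Fin n)) (μ δ r T : ℝ) (hr : 0 ≤ r) (hμ : |μ| * r ≤ 1)
    (H : List (Fin n × (Fin P.coins → Bool))) (hk : (P.run H).exponent ≤ P.coins)
    (hexp : (H.length : ℝ) + 1 ≤ 2 * T →
      (P.run H).exponent = 0 ∨ 2 ^ (P.run H).exponent ≤ r) (u : Fin n) :
    ∑ R, P.potential S μ δ r T ((u, R) :: H) ≤ 2 ^ P.coins * P.potential S μ δ r T H := by
  by_cases hlen : (H.length : ℝ) + 1 ≤ 2 * T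
  swap
  · have h0 : ∀ R, P.potential S μ δ r T ((u, R) :: H) = 0 := by
      intro R
      simp [potential, hlen]
    simp only [h0, Finset.sum_const_zero]
    exact mul_nonneg (by positivity) (P.potential_nonneg _ _ _ _ _ _)
  have hlen' : (H.length : ℝ) ≤ 2 * T := by linarith
  classical
  set X : (Fin P.coins → Bool) → ℝ := fun R => if u ∈ S then
      (if Sampled (P.run H).exponent R then 2 ^ (P.run H).exponent else 0) - 1 else 0 with hX
  have hcons : ∀ R, P.potential S μ δ r T ((u, R) :: H)
      = P.potential S μ δ r T H * Real.exp (-(μ ^ 2 * r)) * Real.exp (μ * X R) := by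
    intro R
    simp only [potential, List.length_cons, Nat.cast_add, Nat.cast_one, if_pos hlen, if_pos hlen',
      dev_cons]
    rw [← Real.exp_add, ← Real.exp_add]
    congr 1
    simp only [hX]
    ring
  have hsum : ∑ R, Real.exp (μ * X R) ≤ 2 ^ P.coins * Real.exp (μ ^ 2 * r) := by
    by_cases hS : u ∈ S
    · simp only [hX, if_pos hS]
      exact sum_exp_sampled_le hk μ r hr hμ (hexp hlen)
    · simp only [hX, if_neg hS, mul_zero, Real.exp_zero, Finset.sum_const, nsmul_eq_mul, mul_one]
      have : (1 : ℝ) ≤ Real.exp (μ ^ 2 * r) := Real.one_le_exp (by positivity)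
      simpa using this
  rw [Finset.sum_congr rfl fun R _ => hcons R, ← Finset.mul_sum]
  have hnn : 0 ≤ P.potential S μ δ r T H * Real.exp (-(μ ^ 2 * r)) :=
    mul_nonneg (P.potential_nonneg _ _ _ _ _ _) (Real.exp_nonneg _)
  refine (mul_le_mul_of_nonneg_left hsum hnn).trans (le_of_eq ?_)
  calc P.potential S μ δ r T H * Real.exp (-(μ ^ 2 * r)) * (2 ^ P.coins * Real.exp (μ ^ 2 * r))
      = 2 ^ P.coins * P.potential S μ δ r T H
          * (Real.exp (-(μ ^ 2 * r)) * Real.exp (μ ^ 2 * r)) := by ring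
    _ = _ := by rw [← Real.exp_add, neg_add_cancel, Real.exp_zero, mul_one]

/-- The sign of the error selects the potential that is at least `1`; up to time `2 * T` the reserve
is still nonnegative. -/
theorem one_le_potential (S : Set (Fin n)) (l δ r T : ℝ) (hl : 0 ≤ l) (hr : 0 ≤ r) (hδ : 0 ≤ δ)
    (H : List (Fin n × (Fin P.coins → Bool))) (h1 : T ≤ H.length) (h2 : (H.length : ℝ) ≤ 2 * T)
    (hdev : δ * H.length ≤ |P.dev S H|) :
    1 ≤ P.potential S l δ r T H + P.potential S (-l) δ r T H := by
  have key : ∀ μ : ℝ, |μ| = l → l * |P.dev S H| = μ * P.dev S H →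
      1 ≤ P.potential S μ δ r T H := by
    intro μ hμ hμd
    simp only [potential, if_pos h2]
    refine Real.one_le_exp ?_
    rw [hμ, ← hμd]
    have h3 : δ * T ≤ |P.dev S H| := (mul_le_mul_of_nonneg_left h1 hδ).trans hdev
    have h4 := mul_le_mul_of_nonneg_left h3 hl
    have h5 : 0 ≤ μ ^ 2 * r * (2 * T - H.length) :=
      mul_nonneg (by positivity) (by linarith)
    linarith
  rcases abs_cases (P.dev S H) with ⟨h, -⟩ | ⟨h, -⟩
  · have := key l (abs_of_nonneg hl) (by rw [h])
    linarith [P.potential_nonneg S (-l) δ r T H]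
  · have := key (-l) (by rw [abs_neg, abs_of_nonneg hl]) (by rw [h]; ring)
    linarith [P.potential_nonneg S l δ r T H]

theorem potential_nil (S : Set (Fin n)) (μ δ r T : ℝ) (hT : 0 ≤ T) :
    P.potential S μ δ r T [] = Real.exp (-(|μ| * δ * T) + μ ^ 2 * r * (2 * T)) := by
  simp [potential, dev, weight, freqOn_nil, hT]

/-- The histories for which the frequency of one of the given sets is badly estimated. -/
def Deviates (F : Finset (Set (Fin n))) (δ : ℝ) (H : List (Fin n × (Fin P.coins → Bool))) :
    Prop :=
  ∃ S ∈ F, δ * H.length < |P.dev S H|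

theorem weight_univ_bounds {F : Finset (Set (Fin n))} (hF : Set.univ ∈ F) {δ : ℝ}
    {H : List (Fin n × (Fin P.coins → Bool))} (hH : ¬ P.Deviates F δ H) :
    |(P.weight Set.univ H : ℝ) - H.length| ≤ δ * H.length := by
  have h : ¬ δ * H.length < |P.dev Set.univ H| := fun h => hH ⟨_, hF, h⟩
  simpa [dev, freqOn_univ] using h

/-- After the first halving there are always at least `half` samples, each of weight `2 ^ exponent`,
while the total weight is at most `(1 + δ) * t ≤ 2 * t`. -/
theorem exponent_bound (hb : 1 ≤ P.half) {F : Finset (Set (Fin n))} (hF : Set.univ ∈ F) {δ : ℝ}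
    (hδ : δ ≤ 1) {H : List (Fin n × (Fin P.coins → Bool))} (hH : ¬ P.Deviates F δ H) :
    (P.run H).exponent = 0 ∨ (2 : ℝ) ^ (P.run H).exponent * P.half ≤ 2 * H.length := by
  refine (P.bounded_run hb H).half_le.imp_right fun h => ?_
  have h1 := (abs_le.1 (P.weight_univ_bounds hF hH)).2
  have h2 : (P.weight Set.univ H : ℝ) = (P.run H).total * 2 ^ (P.run H).exponent := by
    exact_mod_cast P.weight_univ H
  have h3 : (P.half : ℝ) ≤ (P.run H).total := by exact_mod_cast h
  have h4 : (0 : ℝ) < 2 ^ (P.run H).exponent := by positivity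
  have h5 : (0 : ℝ) ≤ H.length := Nat.cast_nonneg _
  nlinarith

/-- Hence `Nat.log 2 m` coins per round are enough to sample with the exact probability. -/
theorem exponent_le_log (hb : 2 ≤ P.half) {F : Finset (Set (Fin n))} (hF : Set.univ ∈ F) {δ : ℝ}
    (hδ : δ ≤ 1) {H : List (Fin n × (Fin P.coins → Bool))} (hH : ¬ P.Deviates F δ H) {m : ℕ}
    (hm : H.length ≤ m) : (P.run H).exponent ≤ Nat.log 2 m := by
  rcases P.exponent_bound (by omega) hF hδ hH with h | h
  · rw [h]
    exact Nat.zero_le _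
  · have h1 : 2 ^ (P.run H).exponent * P.half ≤ 2 * H.length := by exact_mod_cast h
    have h2 : 2 ^ (P.run H).exponent * 2 ≤ 2 ^ (P.run H).exponent * P.half :=
      Nat.mul_le_mul_left _ hb
    have h3 : 2 ^ (P.run H).exponent ≤ m := by omega
    have h4 : m ≠ 0 := by
      have : 0 < 2 ^ (P.run H).exponent := by positivity
      omega
    exact (Nat.le_log_iff_pow_le (by norm_num) h4).2 h3

/-- The sum of the exponential potentials over all sets, signs and time scales. -/
noncomputable def totalPotential (F : Finset (Set (Fin n))) (δ : ℝ)
    (H : List (Fin n × (Fin P.coins → Bool))) : ℝ :=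
  ∑ i ∈ Finset.range (P.coins + 1), ∑ S ∈ F,
    (P.potential S (δ * P.half / (16 * 2 ^ i)) δ (4 * 2 ^ i / P.half) (2 ^ i) H
      + P.potential S (-(δ * P.half / (16 * 2 ^ i))) δ (4 * 2 ^ i / P.half) (2 ^ i) H)

theorem totalPotential_nonneg (F : Finset (Set (Fin n))) (δ : ℝ)
    (H : List (Fin n × (Fin P.coins → Bool))) : 0 ≤ P.totalPotential F δ H :=
  Finset.sum_nonneg fun _ _ => Finset.sum_nonneg fun _ _ =>
    add_nonneg (P.potential_nonneg _ _ _ _ _ _) (P.potential_nonneg _ _ _ _ _ _)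

/-- Accuracy on the universe up to now bounds the next increment: `2 ^ exponent ≤ 2 * t / half ≤ r`
with `r = 4 * T / half` and `T = 2 ^ i`. -/
theorem sum_totalPotential_cons_le (hb : 2 ≤ P.half) {F : Finset (Set (Fin n))}
    (hF : Set.univ ∈ F) {δ : ℝ} (hδ0 : 0 ≤ δ) (hδ : δ ≤ 1) {m : ℕ} (hL : P.coins = Nat.log 2 m)
    {H : List (Fin n × (Fin P.coins → Bool))} (hm : H.length < m) (hH : ¬ P.Deviates F δ H)
    (u : Fin n) :
    ∑ R, P.totalPotential F δ ((u, R) :: H) ≤ 2 ^ P.coins * P.totalPotential F δ H := by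
  have hbpos : (0 : ℝ) < P.half := by
    have : 0 < P.half := by omega
    exact_mod_cast this
  unfold totalPotential
  rw [Finset.sum_comm, Finset.mul_sum]
  refine Finset.sum_le_sum fun i _ => ?_
  rw [Finset.sum_comm, Finset.mul_sum]
  refine Finset.sum_le_sum fun S _ => ?_
  rw [Finset.sum_add_distrib, mul_add]
  have hT : (0 : ℝ) < 2 ^ i := by positivity
  have hμ : |δ * P.half / (16 * 2 ^ i)| * (4 * 2 ^ i / P.half) ≤ 1 := by
    rw [abs_of_nonneg (by positivity)]
    have : δ * P.half / (16 * 2 ^ i) * (4 * 2 ^ i / P.half) = δ / 4 := by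
      field_simp
      norm_num
    linarith
  have hk : (P.run H).exponent ≤ P.coins :=
    (P.exponent_le_log hb hF hδ hH hm.le).trans hL.ge
  have hexp : (H.length : ℝ) + 1 ≤ 2 * 2 ^ i →
      (P.run H).exponent = 0 ∨ (2 : ℝ) ^ (P.run H).exponent ≤ 4 * 2 ^ i / P.half := by
    intro hlen
    refine (P.exponent_bound (by omega) hF hδ hH).imp_right fun h => ?_
    rw [le_div_iff₀ hbpos]
    linarith
  refine add_le_add ?_ ?_
  · exact P.sum_potential_cons_le S _ δ _ _ (by positivity) hμ H hk hexp u
  · exact P.sum_potential_cons_le S _ δ _ _ (by positivity) (by rwa [abs_neg]) H hk hexp u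

/-- A deviation at time `t` is caught by the scale `i = Nat.log 2 t`, for which `2 ^ i ≤ t ≤ 2 * 2 ^
i`. -/
theorem one_le_totalPotential {F : Finset (Set (Fin n))} {δ : ℝ} (hδ : 0 ≤ δ) {m : ℕ}
    (hL : P.coins = Nat.log 2 m) {H : List (Fin n × (Fin P.coins → Bool))} (hm : H.length ≤ m)
    (hH : P.Deviates F δ H) : 1 ≤ P.totalPotential F δ H := by
  obtain ⟨S, hS, hdev⟩ := hH
  have hne : H.length ≠ 0 := by
    intro h
    rw [List.length_eq_zero_iff] at h
    subst h
    simp [dev, weight, freqOn_nil] at hdev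
  set i := Nat.log 2 H.length with hi
  have h1 : (2 : ℝ) ^ i ≤ H.length := by exact_mod_cast Nat.pow_log_le_self 2 hne
  have h2 : (H.length : ℝ) ≤ 2 * 2 ^ i := by
    have := (Nat.lt_pow_succ_log_self (b := 2) (by norm_num) H.length).le
    rw [← hi, pow_succ, mul_comm] at this
    exact_mod_cast this
  have hmem : i ∈ Finset.range (P.coins + 1) := by
    rw [Finset.mem_range, hL, Nat.lt_succ_iff]
    exact Nat.log_mono_right hm
  refine (P.one_le_potential S (δ * P.half / (16 * 2 ^ i)) δ (4 * 2 ^ i / P.half) (2 ^ i)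
    (by positivity) (by positivity) hδ H h1 h2 hdev.le).trans ?_
  refine le_trans ?_ (Finset.single_le_sum (fun i _ => Finset.sum_nonneg fun S _ =>
    add_nonneg (P.potential_nonneg _ _ _ _ _ _) (P.potential_nonneg _ _ _ _ _ _)) hmem)
  exact Finset.single_le_sum (f := fun S =>
    P.potential S (δ * P.half / (16 * 2 ^ i)) δ (4 * 2 ^ i / P.half) (2 ^ i) H
      + P.potential S (-(δ * P.half / (16 * 2 ^ i))) δ (4 * 2 ^ i / P.half) (2 ^ i) H)
    (fun S _ => add_nonneg (P.potential_nonneg _ _ _ _ _ _) (P.potential_nonneg _ _ _ _ _ _)) hS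

/-- At every scale the linear term gives `-δ ^ 2 * half / 16` and the initial reserve costs `δ ^ 2 *
half / 32`. -/
theorem totalPotential_nil (hb : 1 ≤ P.half) (F : Finset (Set (Fin n))) {δ : ℝ} (hδ : 0 ≤ δ) :
    P.totalPotential F δ [] = (P.coins + 1) * F.card * 2 * Real.exp (-(δ ^ 2 * P.half / 32)) := by
  have hbpos : (0 : ℝ) < P.half := by exact_mod_cast hb
  have hpot : ∀ (i : ℕ) (S : Set (Fin n)) (μ : ℝ), |μ| = δ * P.half / (16 * 2 ^ i) →
      P.potential S μ δ (4 * 2 ^ i / P.half) (2 ^ i) []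
        = Real.exp (-(δ ^ 2 * P.half / 32)) := by
    intro i S μ hμ
    rw [P.potential_nil _ _ _ _ _ (by positivity), ← sq_abs μ, hμ]
    congr 1
    have hT : (2 : ℝ) ^ i ≠ 0 := by positivity
    field_simp
    ring
  have habs : ∀ i : ℕ, |δ * P.half / (16 * 2 ^ i)| = δ * P.half / (16 * 2 ^ i) :=
    fun i => abs_of_nonneg (by positivity)
  unfold totalPotential
  simp only [fun i S => hpot i S _ (habs i), fun i S => hpot i S _ ((abs_neg _).trans (habs i)),
    Finset.sum_const, nsmul_eq_mul, Finset.card_range]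
  push_cast
  ring

end SketchParams

/-! ### Encoding the sketch in bits. -/

namespace SketchParams

variable {n : ℕ} {ι : Type*} (P : SketchParams n ι)

/-- Codes for the bounded sketches: exponent, total, and a list of counters for every table. -/
abbrev Code : Type _ :=
  Fin (P.coins + 1) × Fin (2 * P.half) × (ι → Fin P.capacity → Fin n × Fin (2 * P.half))

/-- The sketch with the given code. -/
def decode (g : P.Code) : Sketch n ι :=
  ⟨g.1, g.2.1, fun j x => ∑ i, if (g.2.2 j i).1 = x then ((g.2.2 j i).2 : ℕ) else 0⟩

/-- Unused slots carry counter `0` under an arbitrary key; as decoding adds up slots, they do no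
harm. -/
theorem exists_counters {n K B : ℕ} (hB : 0 < B) (x₀ : Fin n) (c : Fin n → ℕ) (hc : ∀ x, c x < B)
    (hK : (Finset.univ.filter fun x => c x ≠ 0).card ≤ K) :
    ∃ g : Fin K → Fin n × Fin B, ∀ x, ∑ i, (if (g i).1 = x then ((g i).2 : ℕ) else 0) = c x := by
  classical
  set T := Finset.univ.filter fun x => c x ≠ 0 with hT
  obtain ⟨e⟩ : Nonempty (T ↪ Fin K) := by
    rw [Function.Embedding.nonempty_iff_card_le]
    simpa using hK
  obtain ⟨g, hval, hzero⟩ : ∃ g : Fin K → Fin n × Fin B,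
      (∀ y : T, g (e y) = (y.1, ⟨c y.1, hc _⟩)) ∧
        ∀ i, (¬ ∃ y : T, e y = i) → ((g i).2 : ℕ) = 0 := by
    refine ⟨fun i => if h : ∃ y : T, e y = i then (h.choose.1, ⟨c h.choose.1, hc _⟩)
      else (x₀, ⟨0, hB⟩), fun y => ?_, fun i hi => ?_⟩
    · have h : ∃ y' : T, e y' = e y := ⟨y, rfl⟩
      simp only [dif_pos h, e.injective h.choose_spec]
    · simp only [dif_neg hi]
  refine ⟨g, fun x => ?_⟩
  by_cases hx : c x = 0
  · rw [hx]
    refine Finset.sum_eq_zero fun i _ => ?_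
    by_cases h : ∃ y : T, e y = i
    · obtain ⟨y, rfl⟩ := h
      rw [hval y]
      split_ifs with hyx
      · exact (congrArg c hyx).trans hx
      · rfl
    · simp [hzero i h]
  · have hxT : x ∈ T := by simp [hT, hx]
    rw [Finset.sum_eq_single (e ⟨x, hxT⟩)]
    · rw [hval ⟨x, hxT⟩]
      simp
    · intro i _ hi
      by_cases h : ∃ y : T, e y = i
      · obtain ⟨y, rfl⟩ := h
        rw [hval y]
        split_ifs with hyx
        · exact absurd (congrArg e (Subtype.ext hyx)) hi
        · rfl
      · simp [hzero i h]
    · simp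

theorem exists_decode_eq (hb : 1 ≤ P.half) (x₀ : Fin n) {s : Sketch n ι} (hs : P.Bounded s)
    (hk : s.exponent ≤ P.coins) : ∃ g, P.decode g = s := by
  choose g hg using fun j => exists_counters (B := 2 * P.half) (by omega) x₀ (s.table j)
    (fun x => (hs.table_le j x).trans_lt hs.total_lt) (hs.card_le j)
  refine ⟨⟨⟨s.exponent, by omega⟩, ⟨s.total, hs.total_lt⟩, g⟩, ?_⟩
  ext j
  · rfl
  · rfl
  · exact hg _ _

/-- The streaming algorithm that maintains the sketch, stored by means of `dec`. -/
noncomputable def toStreamAlg {A : Type*} {b : ℕ} (dec : (Fin b → Bool) → Sketch n ι)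
    (response : Sketch n ι → A) : StreamAlg (Fin n) A where
  space := b
  coins := P.coins
  init := Function.invFun dec (P.run [])
  update mem u R := Function.invFun dec (P.step (dec mem) u R)
  response mem := response (dec mem)

/-- `Function.invFun` stores junk when a sketch has no code. Along a good past every sketch has one,
so nothing is lost. -/
theorem dec_memory {A : Type*} {b : ℕ} (dec : (Fin b → Bool) → Sketch n ι)
    (response : Sketch n ι → A) (good : List (Fin n × (Fin P.coins → Bool)) → Prop)
    (hdec : ∀ H, good H → ∃ mem, dec mem = P.run H)
    (H : List (P.toStreamAlg dec response).Round) (hplay : (P.toStreamAlg dec response).IsPlay H)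
    (hgood : ∀ past, past <:+ H → good (past.map fun r => (r.update, r.bits))) :
    dec ((P.toStreamAlg dec response).memory H)
      = P.run (H.map fun r => (r.update, r.bits)) := by
  induction H with
  | nil => exact Function.invFun_eq (hdec [] (hgood [] List.suffix_rfl))
  | cons r H ih =>
    have ih' := ih hplay.2 fun past hp => hgood past (hp.trans (List.suffix_cons _ _))
    have h1 : (P.toStreamAlg dec response).memory (r :: H)
        = Function.invFun dec (P.run ((r :: H).map fun r => (r.update, r.bits))) := by
      change r.state = _
      rw [hplay.1]
      change Function.invFun dec (P.step (dec _) _ _) = _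
      rw [ih']
      rfl
    rw [h1]
    exact Function.invFun_eq (hdec _ (hgood _ List.suffix_rfl))

/-- Any function of the sketch can be maintained in the white-box model such that with probability
at least `3 / 4` no frequency of a set in `F` is ever badly estimated. -/
theorem exists_streamAlg [Fintype ι] [DecidableEq ι] {A : Type*} (hb : 2 ≤ P.half) (x₀ : Fin n)
    {F : Finset (Set (Fin n))} (hF : Set.univ ∈ F) {δ : ℝ} (hδ0 : 0 ≤ δ) (hδ : δ ≤ 1) {m : ℕ}
    (hL : P.coins = Nat.log 2 m)
    (hsmall : (P.coins + 1) * F.card * 2 * Real.exp (-(δ ^ 2 * P.half / 32)) ≤ 1 / 4)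
    (response : Sketch n ι → A) :
    ∃ alg : StreamAlg (Fin n) A, alg.space = Nat.clog 2 (Fintype.card P.Code) ∧
      ∀ adv : alg.Adversary, 3 / 4 ≤ (alg.game adv m).toOuterMeasure
        {H | ∀ past, past <:+ H → ∃ H' : List (Fin n × (Fin P.coins → Bool)),
          H'.map Prod.fst = alg.stream past ∧ ¬ P.Deviates F δ H' ∧
          alg.response (alg.memory past) = response (P.run H')} := by
  obtain ⟨e⟩ : Nonempty (P.Code ↪ (Fin (Nat.clog 2 (Fintype.card P.Code)) → Bool)) := by
    rw [Function.Embedding.nonempty_iff_card_le]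
    simpa using Nat.le_pow_clog (by norm_num : 1 < 2) (Fintype.card P.Code)
  obtain ⟨g₀, -⟩ := P.exists_decode_eq (by omega) x₀ (P.bounded_run (by omega) [])
    (by simp [run])
  have : Nonempty P.Code := ⟨g₀⟩
  set dec : (Fin (Nat.clog 2 (Fintype.card P.Code)) → Bool) → Sketch n ι :=
    fun mem => P.decode (Function.invFun e mem) with hdecdef
  have hdec : ∀ H : List (Fin n × (Fin P.coins → Bool)), H.length ≤ m ∧ ¬ P.Deviates F δ H →
      ∃ mem, dec mem = P.run H := by
    rintro H ⟨h1, h2⟩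
    obtain ⟨g, hg⟩ := P.exists_decode_eq (by omega) x₀ (P.bounded_run (by omega) H)
      ((P.exponent_le_log hb hF hδ h2 h1).trans hL.ge)
    refine ⟨e g, ?_⟩
    rw [hdecdef]
    simp only [Function.leftInverse_invFun e.injective g, hg]
  refine ⟨P.toStreamAlg dec response, rfl, fun adv => ?_⟩
  set hist : List (P.toStreamAlg dec response).Round → List (Fin n × (Fin P.coins → Bool)) :=
    fun H => H.map fun r => (r.update, r.bits) with hhist
  have hlen : ∀ H, (hist H).length = H.length := fun H => List.length_map _
  -- Deviation and potential depend only on updates and coins, not on the stored memory, so the step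
  -- bound holds for arbitrary next states.
  have key := (P.toStreamAlg dec response).game_le_of_potential adv m
    (fun H => H.length ≤ m ∧ P.Deviates F δ (hist H)) (fun H => P.totalPotential F δ (hist H))
    (1 / 4) (fun H => P.totalPotential_nonneg F δ _)
    (fun H hm hno u x => P.sum_totalPotential_cons_le hb hF hδ0 hδ hL (H := hist H)
      (by rwa [hlen]) (fun hd => hno H List.suffix_rfl ⟨hm.le, hd⟩) u)
    (fun H hH => P.one_le_totalPotential hδ0 hL ((hlen H).trans_le hH.1) hH.2)
    (by
      change P.totalPotential F δ [] ≤ 1 / 4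
      rwa [P.totalPotential_nil (by omega) F hδ0])
  have h34 : (3 / 4 : ENNReal) = 1 - ENNReal.ofReal (1 / 4) := by
    rw [← ENNReal.ofReal_one, ← ENNReal.ofReal_sub _ (by norm_num)]
    rw [show (1 : ℝ) - 1 / 4 = 3 / 4 by norm_num, ENNReal.ofReal_div_of_pos (by norm_num)]
    norm_num
  rw [h34]
  refine key.trans (MeasureTheory.measure_mono ?_)
  rintro H ⟨⟨hplay, hHm⟩, hno⟩ past hpast
  have hplay' : ∀ H past, past <:+ H → (P.toStreamAlg dec response).IsPlay H →
      (P.toStreamAlg dec response).IsPlay past := by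
    intro H
    induction H with
    | nil =>
      intro past hp hH
      have : past = [] := by simpa using hp
      rwa [this]
    | cons r H ih =>
      intro past hp hH
      rcases List.suffix_cons_iff.1 hp with rfl | h
      · exact hH
      · exact ih past h hH.2
  have hgood : ∀ past, past <:+ H →
      (hist past).length ≤ m ∧ ¬ P.Deviates F δ (hist past) := by
    intro past hp
    have hl : past.length ≤ m := hp.length_le.trans hHm.le
    exact ⟨(hlen past).trans_le hl, fun hd => hno past hp ⟨hl, hd⟩⟩
  refine ⟨hist past, ?_, (hgood past hpast).2, ?_⟩
  · simp [hhist, StreamAlg.stream, Function.comp_def]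
  · exact congrArg response (P.dec_memory dec response _ hdec past (hplay' H past hpast hplay)
      fun p hp => hgood p (hp.trans hpast))

end SketchParams

/-! ### Prefixes, keys and the report. -/

theorem freqOn_mono {n : ℕ} (l : List (Fin n)) {S T : Set (Fin n)} (h : S ⊆ T) :
    freqOn l S ≤ freqOn l T := by
  unfold freqOn
  refine Finset.sum_le_sum fun x _ => ?_
  by_cases hS : x ∈ S
  · simp [hS, h hS]
  · rw [if_neg hS]
    split_ifs <;> positivity

namespace HierarchicalDomain

variable {Prefix : Type*} [PartialOrder Prefix] [OrderTop Prefix] {n h : ℕ}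
  (D : HierarchicalDomain Prefix n h)

theorem exists_leaf_le (p : Prefix) : ∃ x, D.leaf x ≤ p := by
  induction hl : D.level p using Nat.strong_induction_on generalizing p with
  | _ l ih =>
    by_cases hp : IsMin p
    · obtain ⟨x, rfl⟩ := (D.isMin_iff_leaf p).1 hp
      exact ⟨x, le_rfl⟩
    · obtain ⟨q, hq⟩ := not_isMin_iff.1 hp
      obtain ⟨x, hx⟩ := ih (D.level q) (hl ▸ D.level_lt _ _ hq) q rfl
      exact ⟨x, hx.trans hq.le⟩

/-- A representative leaf below a prefix. -/
noncomputable def rep (p : Prefix) : Fin n := (D.exists_leaf_le p).choose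

theorem leaf_rep_le (p : Prefix) : D.leaf (D.rep p) ≤ p := (D.exists_leaf_le p).choose_spec

theorem level_le (p : Prefix) : D.level p ≤ h := by
  rcases eq_or_ne p ⊤ with rfl | hp
  · exact D.level_root.le
  · exact ((D.level_lt p ⊤ hp.lt_top).trans_eq D.level_root).le

theorem eq_of_level_eq {x : Fin n} {p q : Prefix} (hp : D.leaf x ≤ p) (hq : D.leaf x ≤ q)
    (hl : D.level p = D.level q) : p = q := by
  rcases D.ancestors_chain _ _ _ hp hq with h | h
  · exact h.eq_of_not_lt fun hlt => (D.level_lt _ _ hlt).ne hl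
  · exact (h.eq_of_not_lt fun hlt => (D.level_lt _ _ hlt).ne hl.symm).symm

open scoped Classical in
/-- The representative of the ancestor of an element at the given level, if there is one. -/
noncomputable def key (j : Fin (h + 1)) (u : Fin n) : Option (Fin n) :=
  if hp : ∃ p, D.level p = j ∧ D.leaf u ≤ p then some (D.rep hp.choose) else none

/-- A leaf has at most one ancestor on each level, so on a fixed level the representative determines
the prefix. Keys therefore cost `log n` bits, whatever the type of prefixes. -/
theorem key_eq_some_rep_iff {j : Fin (h + 1)} {p : Prefix} (hj : D.level p = j) (u : Fin n) :
    D.key j u = some (D.rep p) ↔ D.leaf u ≤ p := by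
  constructor
  · intro hk
    unfold key at hk
    split_ifs at hk with hp
    obtain ⟨h1, h2⟩ := hp.choose_spec
    have h3 : D.rep hp.choose = D.rep p := Option.some.inj hk
    have h4 : hp.choose = p := D.eq_of_level_eq (D.leaf_rep_le _)
      (h3 ▸ D.leaf_rep_le p) (h1.trans hj.symm)
    rwa [← h4]
  · intro hu
    have hp : ∃ p, D.level p = j ∧ D.leaf u ≤ p := ⟨p, hj, hu⟩
    obtain ⟨h1, h2⟩ := hp.choose_spec
    unfold key
    rw [dif_pos hp, D.eq_of_level_eq h2 hu (h1.trans hj.symm)]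

theorem elements_singleton_eq {j : Fin (h + 1)} {p : Prefix} (hj : D.level p = j) :
    {u | D.key j u = some (D.rep p)} = D.elements {p} := by
  ext u
  simp [elements, D.key_eq_some_rep_iff hj]

theorem elements_top : D.elements {⊤} = Set.univ := by
  ext u
  simp [elements]

open scoped Classical in
/-- The sets of elements below the prefixes. -/
noncomputable def family : Finset (Set (Fin n)) :=
  Finset.univ.filter fun S => ∃ p, D.elements {p} = S

theorem elements_mem_family (p : Prefix) : D.elements {p} ∈ D.family := by
  simp [family]

/-- Ancestors of a leaf form a chain, so such a set is determined by any one of its elements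
together with its cardinality. -/
theorem card_family_le : D.family.card ≤ n * (n + 1) := by
  classical
  have hrep : ∀ S ∈ D.family, ∃ x, x ∈ S := by
    intro S hS
    obtain ⟨p, rfl⟩ : ∃ p, D.elements {p} = S := by simpa [family] using hS
    exact ⟨D.rep p, p, rfl, D.leaf_rep_le p⟩
  have hcard : ∀ S : Set (Fin n), S.ncard < n + 1 := by
    intro S
    have := Set.ncard_le_card S
    simp only [Nat.card_eq_fintype_card, Fintype.card_fin] at this
    omega
  have hinj := Finset.card_le_card_of_injOn (s := D.family)
    (t := (Finset.univ : Finset (Fin n × Fin (n + 1))))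
    (fun S => (if hS : S.Nonempty then hS.some else D.rep ⊤, ⟨S.ncard, hcard S⟩))
    (fun _ _ => by simp) (by
      intro S hS T hT hST
      have hS' : S.Nonempty := hrep S hS
      have hT' : T.Nonempty := hrep T hT
      simp only [dif_pos hS', dif_pos hT', Prod.mk.injEq, Fin.mk.injEq] at hST
      obtain ⟨h1, h2⟩ := hST
      have h3 := hS'.some_mem
      have h4 := hT'.some_mem
      rw [← h1] at h4
      obtain ⟨p, rfl⟩ : ∃ p, D.elements {p} = S := by simpa [family] using hS
      obtain ⟨q, rfl⟩ : ∃ p, D.elements {p} = T := by simpa [family] using hT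
      obtain ⟨p', hp', hxp⟩ := h3
      obtain ⟨q', hq', hxq⟩ := h4
      rw [Set.mem_singleton_iff] at hp' hq'
      subst hp' hq'
      have hmono : ∀ p q : Prefix, p ≤ q → D.elements {p} ⊆ D.elements {q} := by
        rintro p q hpq x ⟨p', hp', hx⟩
        rw [Set.mem_singleton_iff] at hp'
        subst hp'
        exact ⟨q, rfl, hx.trans hpq⟩
      rcases D.ancestors_chain _ _ _ hxp hxq with hpq | hpq
      · exact Set.eq_of_subset_of_ncard_le (hmono _ _ hpq) h2.ge (Set.toFinite _)
      · exact (Set.eq_of_subset_of_ncard_le (hmono _ _ hpq) h2.le (Set.toFinite _)).symm)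
  simpa using hinj

/-- The lower estimate of the frequency of a prefix from the sketch. -/
noncomputable def lowerEstimate (δ : ℝ) (s : Sketch n (Fin (h + 1))) (p : Prefix) : ℝ :=
  2 ^ s.exponent * s.table ⟨D.level p, Nat.lt_succ_of_le (D.level_le p)⟩ (D.rep p)
    - 2 * δ * (s.total * 2 ^ s.exponent)

/-- The report of all prefixes with a positive lower estimate. -/
noncomputable def report (δ : ℝ) (s : Sketch n (Fin (h + 1))) : HHHReport Prefix where
  identified := {p | 0 < D.lowerEstimate δ s p}
  estimate := D.lowerEstimate δ s

/-- Let `W` be the total weight. Since `t ≤ 2 * W`, subtracting `2 * δ * W` covers a sampling error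
`δ * t` without knowing `t`. In units of `ε * t`, the loss is at most `1/20` (sampling) `+ 1/4`
(decrements) `+ 1/4` (rounding) `+ 1/5` (the subtraction). -/
theorem lowerEstimate_spec (P : SketchParams n (Fin (h + 1))) (hkey : P.key = D.key) {ε : ℝ}
    (hε : 0 < ε) (hε1 : ε < 1) (hK : 8 / ε ≤ P.capacity + 1) (hb : 8 / ε ≤ P.half)
    {H : List (Fin n × (Fin P.coins → Bool))} (hH : ¬ P.Deviates D.family (ε / 20) H)
    (p : Prefix) :
    freqOn (H.map Prod.fst) (D.elements {p}) - ε * H.length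
        ≤ D.lowerEstimate (ε / 20) (P.run H) p ∧
      D.lowerEstimate (ε / 20) (P.run H) p ≤ freqOn (H.map Prod.fst) (D.elements {p}) := by
  have hF : Set.univ ∈ D.family := D.elements_top ▸ D.elements_mem_family ⊤
  have hbpos : (0 : ℝ) < P.half := lt_of_lt_of_le (by positivity) hb
  have hb1 : 1 ≤ P.half := by exact_mod_cast hbpos
  set j : Fin (h + 1) := ⟨D.level p, Nat.lt_succ_of_le (D.level_le p)⟩ with hj
  obtain ⟨h1, E, h2, h3⟩ := P.table_spec j H
  have h1p := h1 (D.rep p)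
  have h2p := h2 (D.rep p)
  rw [hkey, D.elements_singleton_eq (j := j) (p := p) rfl] at h1p h2p
  have hW : (P.weight Set.univ H : ℝ) = (P.run H).total * 2 ^ (P.run H).exponent := by
    exact_mod_cast P.weight_univ H
  have hWb := abs_le.1 (P.weight_univ_bounds hF hH)
  have hdev : |P.dev (D.elements {p}) H| ≤ ε / 20 * H.length :=
    not_lt.1 fun h => hH ⟨_, D.elements_mem_family p, h⟩
  have hexp := P.exponent_bound hb1 hF (by linarith) hH
  unfold SketchParams.dev at hdev
  have hdev := abs_le.1 hdev
  unfold lowerEstimate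
  rw [← hj, ← hW]
  set W : ℝ := (P.weight Set.univ H : ℝ) with hWdef
  set f := freqOn (H.map Prod.fst) (D.elements {p}) with hf
  set t : ℝ := (H.length : ℝ) with ht
  have ht0 : 0 ≤ t := Nat.cast_nonneg _
  have h1r : (2 : ℝ) ^ (P.run H).exponent * (P.run H).table j (D.rep p)
      ≤ P.weight (D.elements {p}) H := by exact_mod_cast h1p
  have h2r : (P.weight (D.elements {p}) H : ℝ) + 1
      ≤ 2 ^ (P.run H).exponent * (P.run H).table j (D.rep p) + E + 2 ^ (P.run H).exponent := by
    exact_mod_cast h2p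
  have h3r : (E : ℝ) * (P.capacity + 1) ≤ W := by
    have : E * (P.capacity + 1) ≤ P.weight Set.univ H := le_trans (Nat.le_add_right _ _) h3
    rw [hWdef]
    exact_mod_cast this
  have hεt : 0 ≤ ε * t := by positivity
  have hεt' : ε * t ≤ t := mul_le_of_le_one_left ht0 hε1.le
  have hE : (E : ℝ) ≤ ε / 4 * t := by
    have h4 : (E : ℝ) * (8 / ε) ≤ 2 * t :=
      (mul_le_mul_of_nonneg_left hK (Nat.cast_nonneg _)).trans (by linarith)
    rw [mul_div_assoc', div_le_iff₀ hε] at h4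
    linarith
  -- The `- 1` matters at exponent `0`, where there is no rounding error and `ε * t` may be tiny.
  have hhalf : (2 : ℝ) ^ (P.run H).exponent - 1 ≤ ε / 4 * t := by
    rcases hexp with h0 | h0
    · rw [h0]
      simp only [pow_zero, sub_self]
      positivity
    · have h4 : (2 : ℝ) ^ (P.run H).exponent * (8 / ε) ≤ 2 * t :=
        (mul_le_mul_of_nonneg_left hb (by positivity)).trans h0
      rw [mul_div_assoc', div_le_iff₀ hε] at h4
      linarith
  have hδW : 2 * (ε / 20) * W ≤ ε / 5 * t := by
    have : W ≤ 2 * t := by linarith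
    nlinarith
  have hδW' : ε / 20 * t ≤ 2 * (ε / 20) * W := by
    have : t ≤ 2 * W := by linarith
    nlinarith
  constructor <;> linarith

theorem solvesHHH_report (P : SketchParams n (Fin (h + 1))) (hkey : P.key = D.key) {ε γ : ℝ}
    (hε : 0 < ε) (hε1 : ε < 1) (hγ : ε ≤ γ) (hK : 8 / ε ≤ P.capacity + 1) (hb : 8 / ε ≤ P.half)
    {H : List (Fin n × (Fin P.coins → Bool))} (hH : ¬ P.Deviates D.family (ε / 20) H) :
    SolvesHHH D γ ε (H.map Prod.fst) (D.report (ε / 20) (P.run H)) := by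
  have spec := D.lowerEstimate_spec P hkey hε hε1 hK hb hH
  rw [SolvesHHH, List.length_map]
  refine ⟨fun p _ => spec p, fun q hq => ?_⟩
  have hq' : D.lowerEstimate (ε / 20) (P.run H) q ≤ 0 := not_lt.1 hq
  refine (freqOn_mono _ Set.sdiff_subset).trans ?_
  have := (spec q).1
  have : ε * H.length ≤ γ * H.length := mul_le_mul_of_nonneg_right hγ (Nat.cast_nonneg _)
  linarith

end HierarchicalDomain

/-! ### Numerical estimates for the space bound. -/

theorem natClog_le_log_div {N : ℕ} (hN : 1 ≤ N) :
    (Nat.clog 2 N : ℝ) ≤ Real.log N / Real.log 2 + 1 := by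
  have h2 : (0 : ℝ) < Real.log 2 := Real.log_pos (by norm_num)
  rcases hN.eq_or_lt with rfl | hN
  · simp
  · have h : 2 ^ (Nat.clog 2 N).pred < N := Nat.pow_pred_clog_lt_self (by norm_num) hN
    have h' : (2 : ℝ) ^ (Nat.clog 2 N).pred ≤ N := by exact_mod_cast h.le
    have h3 := Real.log_le_log (by positivity) h'
    rw [Real.log_pow, ← le_div_iff₀ h2] at h3
    have h4 : (Nat.clog 2 N : ℝ) ≤ ((Nat.clog 2 N).pred : ℝ) + 1 := by
      have : Nat.clog 2 N ≤ (Nat.clog 2 N).pred + 1 := by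
        rw [Nat.pred_eq_sub_one]
        omega
      exact_mod_cast this
    linarith

theorem log_log_ge {m : ℕ} (hm : 16 ≤ m) : 1.01 ≤ Real.log (Real.log m) := by
  have h16 : Real.log 16 = 4 * Real.log 2 := by
    rw [show (16 : ℝ) = 2 ^ 4 by norm_num, Real.log_pow]
    norm_num
  have h1 : Real.log 16 ≤ Real.log m :=
    Real.log_le_log (by norm_num) (by exact_mod_cast hm)
  have h2 := Real.log_two_gt_d9
  have h3 := Real.exp_one_lt_d9
  have h4 : Real.exp (0.01 : ℝ) ≤ 1 / 0.99 := by
    have h5 := Real.add_one_le_exp (-0.01 : ℝ)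
    have h6 : Real.exp (0.01 : ℝ) * Real.exp (-0.01) = 1 := by
      rw [← Real.exp_add]
      norm_num
    have h7 := Real.exp_pos (0.01 : ℝ)
    rw [le_div_iff₀ (by norm_num)]
    nlinarith
  rw [Real.le_log_iff_exp_le (by linarith)]
  have h8 : Real.exp (1.01 : ℝ) = Real.exp 1 * Real.exp 0.01 := by
    rw [← Real.exp_add]
    norm_num
  have h9 := Real.exp_pos (0.01 : ℝ)
  have h10 := Real.exp_pos (1 : ℝ)
  rw [h8]
  nlinarith

/-- `16` exceeds `e ^ e`, so the triple logarithm is bounded away from zero and can absorb additive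
constants. -/
theorem log_log_log_ge {m : ℕ} (hm : 16 ≤ m) : 0.009 ≤ Real.log (Real.log (Real.log m)) := by
  have h := log_log_ge hm
  have h1 := Real.one_sub_inv_le_log_of_pos (x := (1.01 : ℝ)) (by norm_num)
  have h2 := Real.log_le_log (by norm_num) h
  norm_num at h1 h2 ⊢
  linarith

theorem log_natLog_add_one_le {m : ℕ} (hm : 16 ≤ m) :
    Real.log (Nat.log 2 m + 1) ≤ 0.7 + Real.log (Real.log m) := by
  have h2 := Real.log_two_gt_d9
  have h2' := Real.log_two_lt_d9
  have hy : 2.77 ≤ Real.log m := by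
    have h1 : Real.log 16 ≤ Real.log m :=
      Real.log_le_log (by norm_num) (by exact_mod_cast hm)
    have h16 : Real.log 16 = 4 * Real.log 2 := by
      rw [show (16 : ℝ) = 2 ^ 4 by norm_num, Real.log_pow]
      norm_num
    linarith
  have hL : (Nat.log 2 m : ℝ) * Real.log 2 ≤ Real.log m := by
    rw [← Real.log_pow]
    refine Real.log_le_log (by positivity) ?_
    exact_mod_cast Nat.pow_log_le_self 2 (by omega : m ≠ 0)
  have hL0 : (0 : ℝ) ≤ Nat.log 2 m := Nat.cast_nonneg _
  have hL1 : (Nat.log 2 m : ℝ) + 1 ≤ 2 * Real.log m := by nlinarith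
  calc Real.log (Nat.log 2 m + 1) ≤ Real.log (2 * Real.log m) :=
        Real.log_le_log (by positivity) hL1
    _ = Real.log 2 + Real.log (Real.log m) := Real.log_mul (by norm_num) (by linarith)
    _ ≤ _ := by linarith

/-- The logarithm that determines the number of samples: it is the logarithm of the number of
deviation events times the inverse of the failure probability. -/
noncomputable def unionLog (n m : ℕ) : ℝ :=
  Real.log (8 * (n * (n + 1)) * (Nat.log 2 m + 1))

/-- Half of the bound on the counters. -/
noncomputable def halfBound (n m : ℕ) (ε : ℝ) : ℕ :=
  ⌈12800 / ε ^ 2 * unionLog n m⌉₊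

theorem one_le_unionLog {n : ℕ} (hn : 1 ≤ n) (m : ℕ) : 1 ≤ unionLog n m := by
  have hn' : (1 : ℝ) ≤ n := by exact_mod_cast hn
  have hL0 : (0 : ℝ) ≤ Nat.log 2 m := Nat.cast_nonneg _
  have h1 : (8 : ℝ) ≤ 8 * (n * (n + 1)) * (Nat.log 2 m + 1) := by
    have h2 : (1 : ℝ) ≤ n * (n + 1) := by nlinarith
    have h3 : (1 : ℝ) ≤ n * (n + 1) * (Nat.log 2 m + 1) := by nlinarith
    linarith
  unfold unionLog
  rw [Real.le_log_iff_exp_le (by linarith)]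
  linarith [Real.exp_one_lt_d9]

/-- A product instead of a sum, so that one more logarithm splits it into terms bounded by `log n`
and `log log log m`. -/
theorem unionLog_le {n m : ℕ} (hn : 1 ≤ n) (hm : 16 ≤ m) :
    unionLog n m ≤ 4.5 * ((1 + Real.log n) * Real.log (Real.log m)) := by
  have hn' : (1 : ℝ) ≤ n := by exact_mod_cast hn
  have h2 := Real.log_two_lt_d9
  have hA : 0 ≤ Real.log n := Real.log_nonneg hn'
  have h8 : Real.log 8 = 3 * Real.log 2 := by
    rw [show (8 : ℝ) = 2 ^ 3 by norm_num, Real.log_pow]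
    norm_num
  have hn1 : Real.log (n + 1) ≤ Real.log 2 + Real.log n := by
    rw [← Real.log_mul (by norm_num) (by positivity)]
    exact Real.log_le_log (by positivity) (by linarith)
  have hl2 := log_log_ge hm
  have h := log_natLog_add_one_le hm
  unfold unionLog
  rw [Real.log_mul (by positivity) (by positivity), Real.log_mul (by norm_num) (by positivity),
    Real.log_mul (by positivity) (by positivity)]
  nlinarith

theorem le_halfBound {n : ℕ} (hn : 1 ≤ n) (m : ℕ) {ε : ℝ} (hε : 0 < ε) (hε1 : ε < 1) :
    8 / ε ≤ halfBound n m ε := by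
  refine le_trans ?_ (Nat.le_ceil _)
  have h1 : (8 : ℝ) / ε ≤ 12800 / ε ^ 2 := by
    rw [div_le_div_iff₀ hε (by positivity)]
    nlinarith
  have h2 : 0 ≤ (12800 : ℝ) / ε ^ 2 := by positivity
  nlinarith [one_le_unionLog hn m]

theorem log_two_mul_halfBound_le {n m : ℕ} (hn : 1 ≤ n) (hm : 16 ≤ m) {ε : ℝ} (hε : 0 < ε)
    (hε1 : ε < 1) : Real.log (2 * halfBound n m ε)
      ≤ 13 + 2 * Real.log (1 / ε) + Real.log n + Real.log (Real.log (Real.log m)) := by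
  have hn' : (1 : ℝ) ≤ n := by exact_mod_cast hn
  have hA : 0 ≤ Real.log n := Real.log_nonneg hn'
  have hl2 := log_log_ge hm
  have h1 := unionLog_le hn hm
  have h0 := one_le_unionLog hn m
  have hb := le_halfBound hn m hε hε1
  have hbpos : (0 : ℝ) < halfBound n m ε := lt_of_lt_of_le (by positivity) hb
  have hinv : 1 ≤ 1 / ε := by rw [le_div_iff₀ hε]; linarith
  set q := (1 + Real.log n) * Real.log (Real.log m) with hq
  have hq1 : 1 ≤ q := by nlinarith
  have hceil : (halfBound n m ε : ℝ) < 12800 / ε ^ 2 * unionLog n m + 1 :=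
    Nat.ceil_lt_add_one (by positivity)
  have hle : 2 * (halfBound n m ε : ℝ) ≤ 2 ^ 18 * ((1 / ε) ^ 2 * q) := by
    have h2 : (12800 : ℝ) / ε ^ 2 = 12800 * (1 / ε) ^ 2 := by ring
    rw [h2] at hceil
    have h3 : 1 ≤ (1 / ε) ^ 2 := one_le_pow₀ hinv
    have h4 : (1 / ε) ^ 2 * unionLog n m ≤ (1 / ε) ^ 2 * (4.5 * q) := by gcongr
    have h5 : 1 ≤ (1 / ε) ^ 2 * q := one_le_mul_of_one_le_of_one_le h3 hq1
    linarith
  have hlog : Real.log (2 ^ 18 * ((1 / ε) ^ 2 * q)) = 18 * Real.log 2 + (2 * Real.log (1 / ε)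
      + (Real.log (1 + Real.log n) + Real.log (Real.log (Real.log m)))) := by
    rw [Real.log_mul (by norm_num) (by positivity), Real.log_mul (by positivity) (by positivity),
      hq, Real.log_mul (by positivity) (by linarith), Real.log_pow, Real.log_pow]
    norm_num
  have h6 : Real.log (1 + Real.log n) ≤ Real.log n := by
    have := Real.log_le_sub_one_of_pos (show 0 < 1 + Real.log n by linarith)
    linarith
  have h7 := Real.log_le_log (by positivity) hle
  rw [hlog] at h7
  linarith [Real.log_two_lt_d9]

/-- The constant `12800 = 32 * 20 ^ 2` makes the exponent at least `unionLog`, whose factor `8` is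
two signs times the inverse of the failure probability `1/4`. -/
theorem failure_le {n : ℕ} (hn : 1 ≤ n) (m : ℕ) {ε : ℝ} (hε : 0 < ε) {c : ℕ}
    (hc : c ≤ n * (n + 1)) :
    ((Nat.log 2 m : ℝ) + 1) * c * 2 * Real.exp (-((ε / 20) ^ 2 * halfBound n m ε / 32))
      ≤ 1 / 4 := by
  have hn' : (1 : ℝ) ≤ n := by exact_mod_cast hn
  set x : ℝ := 8 * (n * (n + 1)) * (Nat.log 2 m + 1) with hx
  have hxpos : 0 < x := by positivity
  have h1 : unionLog n m ≤ (ε / 20) ^ 2 * halfBound n m ε / 32 := by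
    have h2 : 12800 / ε ^ 2 * unionLog n m ≤ halfBound n m ε := Nat.le_ceil _
    rw [div_mul_eq_mul_div, div_le_iff₀ (by positivity)] at h2
    linarith
  have h3 : Real.exp (-((ε / 20) ^ 2 * halfBound n m ε / 32)) ≤ x⁻¹ := by
    rw [← Real.exp_log hxpos, ← Real.exp_neg]
    exact Real.exp_le_exp.2 (neg_le_neg h1)
  have hc' : (c : ℝ) ≤ n * (n + 1) := by exact_mod_cast hc
  calc ((Nat.log 2 m : ℝ) + 1) * c * 2 * Real.exp (-((ε / 20) ^ 2 * halfBound n m ε / 32))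
      ≤ ((Nat.log 2 m : ℝ) + 1) * (n * (n + 1)) * 2 * x⁻¹ := by gcongr
    _ = 1 / 4 := by
      rw [hx]
      field_simp
      norm_num

theorem clog_card_code_le {n h m : ℕ} (hn : 1 ≤ n) (hh : 1 ≤ h) (hm : 16 ≤ m) {ε : ℝ}
    (hε : 0 < ε) (hε1 : ε < 1) (P : SketchParams n (Fin (h + 1)))
    (hK : P.capacity = ⌈8 / ε⌉₊) (hb : P.half = halfBound n m ε) (hL : P.coins = Nat.log 2 m) :
    (Nat.clog 2 (Fintype.card P.Code) : ℝ) ≤ 60000 * ((h : ℝ) / ε *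
      (Real.log n + Real.log (1 / ε) + Real.log (Real.log (Real.log m))) +
        Real.log (Real.log m)) := by
  have hn' : (1 : ℝ) ≤ n := by exact_mod_cast hn
  have hh' : (1 : ℝ) ≤ h := by exact_mod_cast hh
  have hbr := le_halfBound hn m hε hε1
  have hbpos : (0 : ℝ) < halfBound n m ε := lt_of_lt_of_le (by positivity) hbr
  have hb1 : 1 ≤ halfBound n m ε := by exact_mod_cast hbpos
  have hinv : 1 ≤ 1 / ε := by rw [le_div_iff₀ hε]; linarith
  have hcard : Fintype.card P.Code = (Nat.log 2 m + 1) * (2 * halfBound n m ε *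
      ((n * (2 * halfBound n m ε)) ^ ⌈8 / ε⌉₊) ^ (h + 1)) := by
    simp [SketchParams.Code, hK, hb, hL]
  have hpos : 1 ≤ Fintype.card P.Code := by
    rw [hcard]
    exact Nat.one_le_iff_ne_zero.2 (by positivity)
  have hA : 0 ≤ Real.log n := Real.log_nonneg hn'
  have hE : 0 ≤ Real.log (1 / ε) := Real.log_nonneg hinv
  have hl2 := log_log_ge hm
  have hl3 := log_log_log_ge hm
  have hy := log_two_mul_halfBound_le hn hm hε hε1
  have hlL := log_natLog_add_one_le hm
  have hclog := natClog_le_log_div hpos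
  have hlog : Real.log (Fintype.card P.Code) = Real.log (Nat.log 2 m + 1)
      + (Real.log (2 * halfBound n m ε)
        + (⌈8 / ε⌉₊ * (h + 1)) * (Real.log n + Real.log (2 * halfBound n m ε))) := by
    rw [hcard]
    push_cast
    rw [Real.log_mul (by positivity) (by positivity), Real.log_mul (by positivity) (by positivity),
      ← pow_mul, Real.log_pow,
      Real.log_mul (x := (n : ℝ)) (by positivity) (by positivity)]
    push_cast
    ring
  set y := Real.log (2 * halfBound n m ε) with hydef
  have hy0 : 0 ≤ y := Real.log_nonneg (by
    have : (1 : ℝ) ≤ halfBound n m ε := by exact_mod_cast hb1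
    linarith)
  set Q : ℝ := h / ε with hQ
  have hQ1 : 1 ≤ Q := by
    rw [hQ, le_div_iff₀ hε]
    linarith
  have hKh : (⌈8 / ε⌉₊ : ℝ) * (h + 1) ≤ 18 * Q := by
    have h1 : (⌈8 / ε⌉₊ : ℝ) < 8 / ε + 1 := Nat.ceil_lt_add_one (by positivity)
    have h2 : (⌈8 / ε⌉₊ : ℝ) ≤ 9 * (1 / ε) := by
      have h3 : 8 / ε = 8 * (1 / ε) := by ring
      linarith
    calc (⌈8 / ε⌉₊ : ℝ) * (h + 1) ≤ 9 * (1 / ε) * (2 * h) := by gcongr; linarith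
      _ = 18 * Q := by rw [hQ]; ring
  set Z := Real.log n + Real.log (1 / ε) + Real.log (Real.log (Real.log m)) with hZ
  -- The constant `13` is at most `1445` times the triple logarithm, which is at least `0.009`.
  have hyZ : Real.log n + y ≤ 1446 * Z := by linarith
  have hZ0 : 0 ≤ Z := by linarith
  have h1 : (⌈8 / ε⌉₊ * (h + 1)) * (Real.log n + y) ≤ 18 * Q * (1446 * Z) := by gcongr
  have h2 : y ≤ 1446 * (Q * Z) := by
    have : Z ≤ Q * Z := le_mul_of_one_le_left hZ0 hQ1
    linarith
  -- `27474 = (18 + 1) * 1446`: the tables and the sample count.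
  have h3 : Real.log (Fintype.card P.Code) ≤ 27474 * (Q * Z) + 2 * Real.log (Real.log m) := by
    rw [hlog]
    linarith
  have h4 : Real.log (Fintype.card P.Code) / Real.log 2 ≤ 2 * Real.log (Fintype.card P.Code) := by
    rw [div_le_iff₀ (Real.log_pos (by norm_num))]
    have h5 : 0 ≤ Real.log (Fintype.card P.Code) := Real.log_natCast_nonneg _
    have := Real.log_two_gt_d9
    nlinarith
  have h5 : 0 ≤ Q * Z := by positivity
  linarith

/-! ### Choice of parameters and conclusion. -/

theorem mainTheorem11 :
    ∃ C : ℝ, 0 < C ∧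
      ∀ (Prefix : Type*) [PartialOrder Prefix] [OrderTop Prefix] (n h m : ℕ)
        (D : HierarchicalDomain Prefix n h) (ε : ℝ),
        1 ≤ h → 16 ≤ m → 0 < ε → ε < 1 →
        ∃ alg : StreamAlg (Fin n) (ℝ → HHHReport Prefix),
          (alg.space : ℝ) ≤
            C * ((h : ℝ) / ε *
                (Real.log n + Real.log (1 / ε) + Real.log (Real.log (Real.log m))) +
              Real.log (Real.log m)) ∧
          ∀ adv : alg.Adversary,
            3 / 4 ≤ (alg.game adv m).toOuterMeasure
              {H | ∀ past, past <:+ H → past ≠ [] → ∀ γ : ℝ, ε ≤ γ → γ < 1 →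
                SolvesHHH D γ ε (alg.stream past) (alg.response (alg.memory past) γ)} := by
  refine ⟨60000, by norm_num, ?_⟩
  intro Prefix _ _ n h m D ε hh hm hε hε1
  have hn : 1 ≤ n := (Nat.zero_le _).trans_lt (D.rep ⊤).isLt
  have hb8 := le_halfBound hn m hε hε1
  have hb2 : 2 ≤ halfBound n m ε := by
    have h1 : (8 : ℝ) ≤ 8 / ε := by rw [le_div_iff₀ hε]; linarith
    have h2 : (2 : ℝ) ≤ halfBound n m ε := by linarith
    exact_mod_cast h2
  -- There are `h + 1` tables because level `0`, the leaves, needs one too.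
  let P : SketchParams n (Fin (h + 1)) := ⟨⌈8 / ε⌉₊, halfBound n m ε, Nat.log 2 m, D.key⟩
  obtain ⟨alg, hspace, halg⟩ := P.exists_streamAlg hb2 (D.rep ⊤)
    (D.elements_top ▸ D.elements_mem_family ⊤ : Set.univ ∈ D.family) (δ := ε / 20) (by linarith)
    (by linarith) (m := m) rfl (failure_le hn m hε D.card_family_le)
    (fun s (_ : ℝ) => D.report (ε / 20) s)
  refine ⟨alg, ?_, fun adv => (halg adv).trans (MeasureTheory.measure_mono ?_)⟩
  · rw [hspace]
    exact clog_card_code_le hn hh hm hε hε1 P rfl rfl rfl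
  · intro H hH past hpast _ γ hγ _
    obtain ⟨H', h1, h2, h3⟩ := hH past hpast
    rw [← h1, h3]
    exact D.solvesHHH_report P rfl hε hε1 hγ ((Nat.le_ceil _).trans (by simp [P])) hb8 h2
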